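/- Let $G$ be a compact Hausdorff Abelian topological group (written multiplicatively), let $n\ge 0$, and let $\varphi:\mathbb R^n\to G$ be a continuous homomorphism from $(\mathbb R^n,+)$ to $G$. Let $G^\wedge$ be the dual group of $G$, that is, the group of all continuous homomorphisms $\chi:G\to\mathbb S^1=\{z\in\mathbb C:|z|=1\}$. For each $\chi\in G^\wedge$, the map $\chi\circ\varphi$ is a continuous character of $\mathbb R^n$; let $y(\chi)\in\mathbb R^n$ be the unique vector such that $$\chi(\varphi(x))=e^{2\pi i\,y(\chi)\cdot x}\qquad\text{for all }x\in\mathbb R^n .$$ Define the pseudo-metric $p_\varphi:G^\wedge\times G^\wedge\to[0,\infty)$ by $$p_\varphi(\chi_1,\chi_2)=2\pi\,\|y(\chi_1)-y(\chi_2)\|,$$ where $\|\cdot\|$ is the Euclidean norm. Then $p_\varphi$ is a metric on $G^\wedge$ (i.e. $p_\varphi(\chi_1,\chi_2)=0$ implies $\chi_1=\chi_2$) if and only if $\varphi(\mathbb R^n)$ is dense in $G$. -/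

import Mathlib

namespace DualPseudoMetric

/-- Every continuous character `ξ` of `ℝⁿ` (a continuous homomorphism into the unit circle) is of
the form `x ↦ exp (2πi y · x)` for exactly one `y ∈ ℝⁿ`. -/
theorem existsUnique_frequency {n : ℕ}
    (ξ : Multiplicative (EuclideanSpace ℝ (Fin n)) →ₜ* Circle) :
    ∃! y : EuclideanSpace ℝ (Fin n), ∀ x : EuclideanSpace ℝ (Fin n),
      (ξ (Multiplicative.ofAdd x) : ℂ) =
        Complex.exp (2 * Real.pi * Complex.I * (inner ℝ y x : ℝ)) := by
  have hexp : ∀ y x : EuclideanSpace ℝ (Fin n),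
      Complex.exp (2 * Real.pi * Complex.I * (inner ℝ y x : ℝ)) =
        (Circle.exp (2 * Real.pi * inner ℝ y x) : ℂ) := by
    intro y x
    rw [Circle.coe_exp]
    congr 1
    push_cast
    ring
  simp_rw [hexp, Circle.coe_inj]
  have hπ : (2 * Real.pi) ≠ 0 := by positivity
  have cov := Circle.isCoveringMap_exp
  let f : C(EuclideanSpace ℝ (Fin n), Circle) :=
    ⟨fun x => ξ (Multiplicative.ofAdd x), ξ.continuous_toFun.comp continuous_ofAdd⟩
  have hf0 : f 0 = 1 := map_one ξ
  obtain ⟨F, ⟨hF0, hF⟩, -⟩ := cov.existsUnique_continuousMap_lifts f 0 (0 : ℝ) (by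
    rw [hf0, Circle.exp_zero])
  have hF' : ∀ x, Circle.exp (F x) = f x := fun x => congrFun hF x
  have hadd : (fun p : EuclideanSpace ℝ (Fin n) × EuclideanSpace ℝ (Fin n) => F (p.1 + p.2)) =
      fun p => F p.1 + F p.2 := by
    refine cov.eq_of_comp_eq (by fun_prop) (by fun_prop) ?_ (0, 0) (by simp [hF0])
    funext p
    simp only [Function.comp_apply, Circle.exp_add, hF']
    exact map_mul ξ (Multiplicative.ofAdd p.1) (Multiplicative.ofAdd p.2)
  let A : EuclideanSpace ℝ (Fin n) →+ ℝ :=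
    { toFun := F, map_zero' := hF0, map_add' := fun x y => congrFun hadd (x, y) }
  let L : EuclideanSpace ℝ (Fin n) →L[ℝ] ℝ := A.toRealLinearMap F.continuous
  refine ⟨(2 * Real.pi)⁻¹ • (InnerProductSpace.toDual ℝ _).symm L, fun x => ?_, fun y hy => ?_⟩
  · rw [real_inner_smul_left, InnerProductSpace.toDual_symm_apply, mul_inv_cancel_left₀ hπ]
    exact (hF' x).symm
  · have h : (fun x : EuclideanSpace ℝ (Fin n) => 2 * Real.pi * inner ℝ y x) = F := by
      refine cov.eq_of_comp_eq (by fun_prop) F.continuous ?_ 0 (by simp [hF0])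
      funext x
      simp only [Function.comp_apply, hF']
      exact (hy x).symm
    refine ext_inner_right ℝ fun x => ?_
    rw [real_inner_smul_left, InnerProductSpace.toDual_symm_apply]
    have hx : 2 * Real.pi * inner ℝ y x = L x := congrFun h x
    rw [← hx, inv_mul_cancel_left₀ hπ]

variable {n : ℕ} {G : Type*} [CommGroup G] [TopologicalSpace G]

/-- The vector `y(χ) ∈ ℝⁿ` determined by `χ (φ x) = exp (2πi y(χ) · x)` for all `x ∈ ℝⁿ`, for a
continuous homomorphism `φ : ℝⁿ → G` and a continuous character `χ` of `G`. -/
noncomputable def frequency (φ : Multiplicative (EuclideanSpace ℝ (Fin n)) →ₜ* G)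
    (χ : PontryaginDual G) : EuclideanSpace ℝ (Fin n) :=
  (existsUnique_frequency (ContinuousMonoidHom.comp (χ : G →ₜ* Circle) φ)).choose

theorem frequency_spec (φ : Multiplicative (EuclideanSpace ℝ (Fin n)) →ₜ* G)
    (χ : PontryaginDual G) (x : EuclideanSpace ℝ (Fin n)) :
    (χ (φ (Multiplicative.ofAdd x)) : ℂ) =
      Complex.exp (2 * Real.pi * Complex.I * (inner ℝ (frequency φ χ) x : ℝ)) :=
  (existsUnique_frequency (ContinuousMonoidHom.comp (χ : G →ₜ* Circle) φ)).choose_spec.1 x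

/-- The pseudo-metric `p_φ(χ₁, χ₂) = 2π ‖y(χ₁) - y(χ₂)‖` on the dual group of `G`. -/
noncomputable def dualPseudoMetric (φ : Multiplicative (EuclideanSpace ℝ (Fin n)) →ₜ* G) :
    PseudoMetric (PontryaginDual G) ℝ where
  toFun χ₁ χ₂ := 2 * Real.pi * ‖frequency φ χ₁ - frequency φ χ₂‖
  refl' χ := by simp
  symm' χ₁ χ₂ := by rw [norm_sub_rev]
  triangle' χ₁ χ₂ χ₃ := by
    rw [← mul_add]
    exact mul_le_mul_of_nonneg_left (norm_sub_le_norm_sub_add_norm_sub _ _ _) (by positivity)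

/-- A pseudo-metric is a metric if it separates points. -/
def IsMetric {X : Type*} (p : PseudoMetric X ℝ) : Prop :=
  ∀ x y : X, p x y = 0 → x = y

end DualPseudoMetric

/-! `p_φ(χ₁, χ₂) = 0` exactly when `χ₁` and `χ₂` agree on the image of `φ`, so a dense image gives a
metric by continuity. Otherwise the closure `H` of the image is a proper closed subgroup, and a
nontrivial character of `G ⧸ H` pulls back to one at distance 0 from the trivial character. This
needs characters to separate points (`exists_character_ne_one`). The regular representation on `L²`
is faithful and its operators generate a commutative C⋆-algebra, so Gelfand theory supplies a
homomorphism `ω` to `ℂ` with `ω (U g₀) ≠ 1`. Choosing `ω` nonzero on some integrated operator makes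
`g ↦ ω (U g)` continuous. -/

open MeasureTheory WeakDual

namespace UnitaryRep

/-! ### Gelfand theory on a commutative double commutant -/

section Commutant

variable {A : Type*} [CStarAlgebra A]

/-- The double commutant of the star-closure of a set. -/
def doubleCommutant (s : Set A) : StarSubalgebra ℂ A :=
  StarSubalgebra.centralizer ℂ (StarSubalgebra.centralizer ℂ s : Set A)

theorem subset_doubleCommutant (s : Set A) : s ⊆ doubleCommutant s :=
  (StarAlgebra.subset_adjoin ℂ s).trans (StarAlgebra.adjoin_le_centralizer_centralizer ℂ s)

theorem mem_doubleCommutant_of_commute {s : Set A} {a : A}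
    (h : ∀ z ∈ StarSubalgebra.centralizer ℂ s, z * a = a * z) : a ∈ doubleCommutant s :=
  StarSubalgebra.mem_centralizer_iff ℂ |>.2 fun z hz => ⟨h z hz, h _ (star_mem hz)⟩

theorem isClosed_doubleCommutant (s : Set A) : IsClosed (doubleCommutant s : Set A) :=
  Set.isClosed_centralizer _

theorem mul_comm_of_mem_doubleCommutant {s : Set A} (hs : ∀ x ∈ s, ∀ y ∈ s, x * y = y * x)
    (hs' : ∀ x ∈ s, ∀ y ∈ s, x * star y = star y * x) {a b : A}
    (ha : a ∈ doubleCommutant s) (hb : b ∈ doubleCommutant s) : a * b = b * a := by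
  rw [doubleCommutant, ← SetLike.mem_coe, StarSubalgebra.coe_centralizer_centralizer] at ha hb
  exact Set.centralizer_centralizer_comm_of_comm (fun x hx y hy =>
    Set.union_star_self_comm (fun _ ha _ hb ↦ hs _ hb _ ha)
      (fun _ ha _ hb ↦ hs' _ hb _ ha) y hy x hx) _ ha _ hb

/-- Star homomorphisms to `ℂ` separate the points of the double commutant of a commutative set. -/
theorem exists_starAlgHom_ne_zero {s : Set A} (hs : ∀ x ∈ s, ∀ y ∈ s, x * y = y * x)
    (hs' : ∀ x ∈ s, ∀ y ∈ s, x * star y = star y * x) {a : doubleCommutant s} (ha : a ≠ 0) :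
    ∃ ω : doubleCommutant s →⋆ₐ[ℂ] ℂ, Continuous ω ∧ ω a ≠ 0 := by
  let _ : CStarAlgebra (doubleCommutant s) :=
    StarSubalgebra.cstarAlgebra _ (h_closed := isClosed_doubleCommutant s)
  let _ : CommCStarAlgebra (doubleCommutant s) :=
    { (inferInstance : CStarAlgebra (doubleCommutant s)) with
      mul_comm := fun a b => Subtype.ext (mul_comm_of_mem_doubleCommutant hs hs' a.2 b.2) }
  have h : gelfandTransform ℂ (doubleCommutant s) a ≠ 0 := by
    rw [← map_zero (gelfandTransform ℂ (doubleCommutant s))]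
    exact (gelfandTransform_isometry _).injective.ne ha
  obtain ⟨ω, hω⟩ := DFunLike.ne_iff.1 h
  exact ⟨{ CharacterSpace.toAlgHom ω with map_star' := map_star ω }, map_continuous ω, hω⟩

end Commutant

/-! ### Integrated operators of a unitary representation -/

variable {G E : Type*} [Group G]
  [NormedAddCommGroup E] [InnerProductSpace ℂ E] [CompleteSpace E]
  {U : G →* unitary (E →L[ℂ] E)}

theorem norm_apply (g : G) (v : E) : ‖(U g : E →L[ℂ] E) v‖ = ‖v‖ :=
  (Unitary.linearIsometryEquiv (U g)).norm_map v

variable [TopologicalSpace G] [CompactSpace G] [MeasurableSpace G] [BorelSpace G]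

theorem integrable_smul_apply (μ : Measure G) [IsFiniteMeasure μ]
    (hU : ∀ v, Continuous fun g => (U g : E →L[ℂ] E) v)
    (f : C(G, ℂ)) (v : E) : Integrable (fun g => f g • (U g : E →L[ℂ] E) v) μ :=
  (f.continuous.smul (hU v)).integrable_of_hasCompactSupport (.of_compactSpace _)

/-- The operators `v ↦ ∫ f(g) U(g) v dμ(g)` of the integrated representation. -/
noncomputable def integrated (μ : Measure G) [IsProbabilityMeasure μ]
    (hU : ∀ v, Continuous fun g => (U g : E →L[ℂ] E) v) : C(G, ℂ) →L[ℂ] E →L[ℂ] E :=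
  LinearMap.mkContinuous₂
    (LinearMap.mk₂ ℂ (fun (f : C(G, ℂ)) (v : E) => ∫ g, f g • (U g : E →L[ℂ] E) v ∂μ)
      (fun f₁ f₂ v => by
        simp only [ContinuousMap.add_apply, add_smul]
        exact integral_add (integrable_smul_apply μ hU f₁ v) (integrable_smul_apply μ hU f₂ v))
      (fun c f v => by
        simp only [ContinuousMap.smul_apply, smul_assoc]
        exact integral_smul c _)
      (fun f v₁ v₂ => by
        simp only [map_add, smul_add]
        exact integral_add (integrable_smul_apply μ hU f v₁) (integrable_smul_apply μ hU f v₂))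
      (fun c f v => by
        simp only [map_smul, smul_comm _ c]
        exact integral_smul c _)) 1
    (fun f v => by
      have h := norm_integral_le_of_norm_le_const (μ := μ) (C := ‖f‖ * ‖v‖)
        (f := fun g => f g • (U g : E →L[ℂ] E) v) (.of_forall fun g => by
          rw [norm_smul, norm_apply]
          gcongr
          exact f.norm_coe_le_norm g)
      simpa using h)

variable (μ : Measure G) [IsProbabilityMeasure μ]
  (hU : ∀ v, Continuous fun g => (U g : E →L[ℂ] E) v)

theorem integrated_apply (f : C(G, ℂ)) (v : E) :
    integrated μ hU f v = ∫ g, f g • (U g : E →L[ℂ] E) v ∂μ := rfl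

theorem integrated_mem_doubleCommutant (f : C(G, ℂ)) :
    integrated μ hU f ∈ doubleCommutant (Set.range fun g => (U g : E →L[ℂ] E)) := by
  refine mem_doubleCommutant_of_commute fun z hz => ContinuousLinearMap.ext fun v => ?_
  simp only [mul_apply_eq_comp, integrated_apply]
  rw [← z.integral_comp_comm (integrable_smul_apply μ hU f v)]
  refine integral_congr_ae (.of_forall fun g => ?_)
  have h := ((StarSubalgebra.mem_centralizer_iff ℂ).1 hz _ ⟨g, rfl⟩).1
  have h' := congrArg (fun T : E →L[ℂ] E => T v) h
  simp only [mul_apply_eq_comp] at h'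
  simp [h']

theorem exists_integrated_apply_ne_zero [μ.IsOpenPosMeasure] {w : E} (hw : w ≠ 0) :
    ∃ f, integrated μ hU f w ≠ 0 := by
  have hc : Continuous fun g => inner ℂ w ((U g : E →L[ℂ] E) w) := continuous_const.inner (hU w)
  -- With `f` the conjugate matrix coefficient, `⟪w, integrated μ hU f w⟫` is the integral of `|⟪w,
  -- U g w⟫|²`, which is positive because the integrand is continuous and nonzero at `g = 1`.
  refine ⟨⟨fun g => star (inner ℂ w ((U g : E →L[ℂ] E) w)), hc.star⟩, fun h => ?_⟩
  have h0 : inner ℂ w (integrated μ hU ⟨_, hc.star⟩ w) = 0 := by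
    rw [h, inner_zero_right]
  rw [integrated_apply, ← integral_inner (integrable_smul_apply μ hU _ w)] at h0
  have h1 : ∀ g, inner ℂ w (star (inner ℂ w ((U g : E →L[ℂ] E) w)) • (U g : E →L[ℂ] E) w) =
      ((‖inner ℂ w ((U g : E →L[ℂ] E) w)‖ ^ 2 : ℝ) : ℂ) := fun g => by
    rw [inner_smul_right]
    simpa using RCLike.conj_mul (inner ℂ w ((U g : E →L[ℂ] E) w))
  simp only [ContinuousMap.coe_mk, h1, integral_complex_ofReal, Complex.ofReal_eq_zero] at h0
  refine ((hc.norm.pow 2).integral_pos_of_hasCompactSupport_nonneg_nonzero (x := 1)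
    (.of_compactSpace _) (fun g => sq_nonneg _) ?_).ne' h0
  simpa using hw

variable [IsTopologicalGroup G]

/-- Left translation of continuous functions. -/
noncomputable def translate (f : C(G, ℂ)) : C(G, C(G, ℂ)) :=
  ContinuousMap.curry ⟨fun p : G × G => f (p.1⁻¹ * p.2), by fun_prop⟩

/-- Moves the dependence on `g` from `U g`, only strongly continuous, into the translate of `f`,
which is continuous in sup norm. -/
theorem mul_integrated [μ.IsMulLeftInvariant] (f : C(G, ℂ)) (g : G) :
    (U g : E →L[ℂ] E) * integrated μ hU f = integrated μ hU (translate f g) := by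
  ext v
  rw [mul_apply_eq_comp, integrated_apply, integrated_apply,
    ← ContinuousLinearMap.integral_comp_comm _ (integrable_smul_apply μ hU f v),
    ← integral_mul_left_eq_self (fun h => translate f g h • (U h : E →L[ℂ] E) v) g]
  simp [translate]

end UnitaryRep
-- Continuous characters from unitary representations
namespace UnitaryRep

theorem exists_continuous_character {G E : Type*} [CommGroup G] [TopologicalSpace G]
    [IsTopologicalGroup G] [CompactSpace G]
    [NormedAddCommGroup E] [InnerProductSpace ℂ E] [CompleteSpace E]
    {U : G →* unitary (E →L[ℂ] E)} (hU : ∀ v, Continuous fun g => (U g : E →L[ℂ] E) v)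
    {g₀ : G} (hg : U g₀ ≠ 1) : ∃ χ : G →ₜ* Circle, χ g₀ ≠ 1 := by
  borelize G
  let μ : Measure G := Measure.haarMeasure ⊤
  have : IsProbabilityMeasure μ := ⟨Measure.haarMeasure_self⟩
  obtain ⟨v, hv⟩ : ∃ v, (U g₀ : E →L[ℂ] E) v ≠ v := by
    by_contra! h
    exact hg (Subtype.ext (ContinuousLinearMap.ext h))
  obtain ⟨f, hf⟩ := exists_integrated_apply_ne_zero μ hU (sub_ne_zero.2 hv)
  set s : Set (E →L[ℂ] E) := Set.range fun g => (U g : E →L[ℂ] E)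
  have hcomm : ∀ x ∈ s, ∀ y ∈ s, x * y = y * x := by
    rintro _ ⟨g, rfl⟩ _ ⟨h, rfl⟩
    simp only [← Submonoid.coe_mul, ← map_mul, mul_comm]
  have hstar : ∀ x ∈ s, star x ∈ s := by
    rintro _ ⟨g, rfl⟩
    exact ⟨g⁻¹, congrArg Subtype.val (map_inv U g)⟩
  let u : G →* doubleCommutant s :=
    { toFun := fun g => ⟨U g, subset_doubleCommutant s ⟨g, rfl⟩⟩
      map_one' := by ext1; simp
      map_mul' := fun g h => by ext1; simp }
  let T : C(G, ℂ) → doubleCommutant s := fun f =>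
    ⟨integrated μ hU f, integrated_mem_doubleCommutant μ hU f⟩
  have hT : Continuous T := (integrated μ hU).continuous.subtype_mk _
  -- One nonvanishing product gives both `ω (T f) ≠ 0`, needed for continuity, and `ω (u g₀) ≠ 1`.
  have ha : T f * (u g₀ - 1) ≠ 0 := fun h => hf <| by
    have := congrArg (fun a : doubleCommutant s => (a : E →L[ℂ] E) v) h
    simpa [T, u] using this
  obtain ⟨ω, hω, hωa⟩ := exists_starAlgHom_ne_zero hcomm
    (fun x hx y hy => hcomm x hx _ (hstar y hy)) ha
  rw [map_mul, map_sub, map_one] at hωa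
  have hωT : ω (T f) ≠ 0 := left_ne_zero_of_mul hωa
  have hunit : ∀ g, ω (u g) ∈ Submonoid.unitSphere ℂ := fun g => by
    have h : star (u g) * u g = 1 := by ext1; simp [u]
    have h' := congrArg ω h
    rw [map_mul, map_star, map_one] at h'
    have h2 : ‖ω (u g)‖ * ‖ω (u g)‖ = 1 := by simpa using congrArg norm h'
    simpa [Submonoid.unitSphere] using (mul_self_eq_one_iff.1 h2).resolve_right
      (by linarith [norm_nonneg (ω (u g))])
  -- `ω` is norm continuous but `u` need not be; multiplying by `T f` and dividing by `ω (T f)`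
  -- repairs this.
  have hcont : Continuous fun g => ω (u g) := by
    have h : ∀ g, ω (u g) = ω (T (translate f g)) / ω (T f) := fun g => by
      rw [eq_div_iff hωT, ← map_mul]
      exact congrArg ω (Subtype.ext (mul_integrated μ hU f g))
    simp only [h]
    exact (hω.comp (hT.comp (translate f).continuous)).div_const _
  refine ⟨⟨{ toFun := fun g => ⟨ω (u g), hunit g⟩, map_one' := ?_, map_mul' := ?_ },
    hcont.subtype_mk _⟩, fun h => right_ne_zero_of_mul hωa ?_⟩
  · ext; simp
  · intro g h
    exact Circle.ext ((congrArg ω (map_mul u g h)).trans (map_mul ω _ _))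
  · rw [sub_eq_zero]
    exact congrArg Subtype.val h

end UnitaryRep

/-! ### The regular representation and separation of points -/

section Regular

open scoped ENNReal

variable {G : Type*} [CommGroup G] [TopologicalSpace G] [IsTopologicalGroup G]
  [MeasurableSpace G] [BorelSpace G] (μ : Measure G) [μ.IsMulLeftInvariant]

/-- The regular representation of a commutative group on `L²`. -/
noncomputable def regularRep : G →* unitary (Lp ℂ 2 μ →L[ℂ] Lp ℂ 2 μ) :=
  (Unitary.linearIsometryEquiv (𝕜 := ℂ) (H := Lp ℂ 2 μ)).symm.toMonoidHom.comp
    { toFun := fun g => ⟨DistribMulAction.toLinearEquiv ℂ (Lp ℂ 2 μ) (DomMulAct.mk g),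
        fun v => DomMulAct.norm_smul_Lp _ v⟩
      map_one' := by ext1 v; exact one_smul Gᵈᵐᵃ v
      map_mul' := fun g h => by
        ext1 v
        -- `DomMulAct.mk` reverses products, so commutativity of `G` is what makes this a
        -- homomorphism.
        rw [mul_comm g h]
        exact mul_smul (DomMulAct.mk g) (DomMulAct.mk h) v }

theorem regularRep_apply (g : G) (v : Lp ℂ 2 μ) :
    (regularRep μ g : Lp ℂ 2 μ →L[ℂ] Lp ℂ 2 μ) v = DomMulAct.mk g • v := rfl

theorem continuous_regularRep [R1Space G] [IsLocallyFiniteMeasure μ] [μ.InnerRegularCompactLTTop]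
    (v : Lp ℂ 2 μ) :
    Continuous fun g => (regularRep μ g : Lp ℂ 2 μ →L[ℂ] Lp ℂ 2 μ) v := by
  have : Fact ((2 : ℝ≥0∞) ≠ ∞) := ⟨by simp⟩
  simp only [regularRep_apply]
  exact (continuous_id.smul continuous_const).comp DomMulAct.continuous_mk

theorem regularRep_ne_one [CompactSpace G] [T2Space G] [IsFiniteMeasure μ] [μ.IsOpenPosMeasure]
    {g : G} (hg : g ≠ 1) : regularRep μ g ≠ 1 := fun h => by
  obtain ⟨f, hf0, hf1, -⟩ := exists_continuous_zero_one_of_isClosed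
    (isClosed_singleton (x := (1 : G))) (isClosed_singleton (x := g)) (by simpa using hg.symm)
  let F : C(G, ℂ) := ⟨fun x => (f x : ℂ), by fun_prop⟩
  let F' : C(G, ℂ) := ⟨fun x => (f (g * x) : ℂ), by fun_prop⟩
  -- If `g` acted trivially, the Urysohn function and its translate would agree in `L²`, hence
  -- everywhere since `μ` charges open sets; they differ at 1.
  have hF : ContinuousMap.toLp 2 μ ℂ F' = ContinuousMap.toLp 2 μ ℂ F := by
    have := congrArg (fun T : unitary (Lp ℂ 2 μ →L[ℂ] Lp ℂ 2 μ) =>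
      (T : Lp ℂ 2 μ →L[ℂ] Lp ℂ 2 μ) (ContinuousMap.toLp 2 μ ℂ F)) h
    exact this
  have h1 := DFunLike.congr_fun (ContinuousMap.toLp_injective μ hF) 1
  have e0 : f 1 = 0 := hf0 rfl
  have e1 : f g = 1 := hf1 rfl
  simp [F, F', e0, e1] at h1

end Regular

/-- Continuous characters separate the points of a compact Hausdorff abelian group. -/
theorem exists_character_ne_one {G : Type*} [CommGroup G] [TopologicalSpace G]
    [IsTopologicalGroup G] [CompactSpace G] [T2Space G] {g : G} (hg : g ≠ 1) :
    ∃ χ : G →ₜ* Circle, χ g ≠ 1 := by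
  borelize G
  let μ : Measure G := Measure.haarMeasure ⊤
  exact UnitaryRep.exists_continuous_character (continuous_regularRep μ) (regularRep_ne_one μ hg)

/-- A closed subgroup of a compact Hausdorff abelian group is cut out by continuous characters. -/
theorem Subgroup.exists_character_ne_one_of_notMem {G : Type*} [CommGroup G] [TopologicalSpace G]
    [IsTopologicalGroup G] [CompactSpace G] {H : Subgroup G} (hH : IsClosed (H : Set G))
    {g : G} (hg : g ∉ H) : ∃ χ : G →ₜ* Circle, χ g ≠ 1 ∧ ∀ h ∈ H, χ h = 1 := by
  -- `G ⧸ H` is Hausdorff because `H` is closed; instance search picks up `hH`.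
  obtain ⟨χ, hχ⟩ := exists_character_ne_one (g := (g : G ⧸ H))
    (by rwa [Ne, QuotientGroup.eq_one_iff])
  refine ⟨χ.comp ⟨QuotientGroup.mk' H, QuotientGroup.continuous_mk⟩, hχ, fun h hh => ?_⟩
  have : (h : G ⧸ H) = 1 := (QuotientGroup.eq_one_iff h).2 hh
  exact (congrArg χ this).trans (map_one χ)

/-! ### Vanishing of the pseudo-metric and density -/

namespace DualPseudoMetric

theorem dualPseudoMetric_eq_zero_iff {n : ℕ} {G : Type*} [CommGroup G] [TopologicalSpace G]
    (φ : Multiplicative (EuclideanSpace ℝ (Fin n)) →ₜ* G) (χ₁ χ₂ : PontryaginDual G) :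
    dualPseudoMetric φ χ₁ χ₂ = 0 ↔ ∀ x, χ₁ (φ x) = χ₂ (φ x) := by
  have h : dualPseudoMetric φ χ₁ χ₂ = 0 ↔ frequency φ χ₁ = frequency φ χ₂ := by
    change 2 * Real.pi * ‖frequency φ χ₁ - frequency φ χ₂‖ = 0 ↔ _
    simp [Real.pi_ne_zero, sub_eq_zero]
  rw [h]
  constructor
  · intro h x
    ext
    exact (frequency_spec φ χ₁ x.toAdd).trans ((h ▸ frequency_spec φ χ₂ x.toAdd).symm)
  · intro h
    refine (existsUnique_frequency (ContinuousMonoidHom.comp (χ₁ : G →ₜ* Circle) φ)).unique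
      (frequency_spec φ χ₁) fun x => ?_
    exact (congrArg _ (h _)).trans (frequency_spec φ χ₂ x)

end DualPseudoMetric

theorem claim2 {n : ℕ} {G : Type*} [CommGroup G] [TopologicalSpace G] [IsTopologicalGroup G]
    [CompactSpace G] [T2Space G] (φ : Multiplicative (EuclideanSpace ℝ (Fin n)) →ₜ* G) :
    DualPseudoMetric.IsMetric (DualPseudoMetric.dualPseudoMetric φ) ↔
      Dense (Set.range φ) := by
  simp only [DualPseudoMetric.IsMetric, DualPseudoMetric.dualPseudoMetric_eq_zero_iff]
  constructor
  · intro h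
    by_contra hd
    obtain ⟨g, hg⟩ : ∃ g, g ∉ closure (Set.range φ) := by
      simpa [Dense] using hd
    obtain ⟨χ, hχg, hχ⟩ := Subgroup.exists_character_ne_one_of_notMem
      (H := (φ : Multiplicative (EuclideanSpace ℝ (Fin n)) →* G).range.topologicalClosure)
      (Subgroup.isClosed_topologicalClosure _) hg
    refine hχg (DFunLike.congr_fun (h (χ : PontryaginDual G) 1 fun x => ?_) g)
    exact hχ _ (Subgroup.le_topologicalClosure _ ⟨x, rfl⟩)
  · intro hd χ₁ χ₂ h
    refine PontryaginDual.ext fun g => congrFun (Continuous.ext_on hd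
      (map_continuous χ₁) (map_continuous χ₂) ?_) g
    rintro _ ⟨x, rfl⟩
    exact h x
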